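/- Let $p$ be a prime, let $f_1(x)=px$ and $f_2(x)=px+1-p$ on $\mathbb Z_p$, and let $\xi=(\xi_{ij})$ be a $2\times 2$ matrix with entries in $\{1,2\}$; in particular $\xi$ may be any of $$\begin{pmatrix}2&2\\2&2\end{pmatrix},\quad \begin{pmatrix}2&1\\2&1\end{pmatrix},\quad \begin{pmatrix}2&2\\1&1\end{pmatrix},\quad \begin{pmatrix}2&1\\1&1\end{pmatrix}.$$ For $a,b\in\{1,2\}$ let $a*b=1$ if $a+b$ is odd and $a*b=2$ if $a+b$ is even. For $\alpha\in\{1,2\}^{\mathbb N}$ and $n\ge 1$ put $$F_{\alpha,n}=\sum_{i=1}^{2}\prod_{j=1}^{2} f_{\xi_{ij}*\alpha_1}\circ\cdots\circ f_{\xi_{ij}*\alpha_n},\qquad \mathcal F_\xi=\{F_{\alpha,n}:\alpha\in\{1,2\}^{\mathbb N},\ n\ge 1\}.$$ Let $\Omega^\xi$ be the set of $x\in\mathbb Z_p$ for which there is $r>0$ such that, with $B_r(x)=\{y\in\mathbb Z_p:|y-x|_p\le r\}$, one has $F(B_r(x))\cap B_r(x)\neq\emptyset$ for only finitely many $F\in\mathcal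 F_\xi$, and let $\Lambda^\xi=\mathbb Z_p\setminus\Omega^\xi$ be the unconventional limit set, with the $p$-adic metric. Then the following hold. 1. $\Lambda^\xi$ is uniformly perfect: it is bounded, has at least two points, and there is $c>0$ such that for all $x_0\in\Lambda^\xi$ and $0<r<\operatorname{diam}\Lambda^\xi$ some $x\in\Lambda^\xi$ satisfies $cr\le|x-x_0|_p\le r$. 2. $\Lambda^\xi$ is doubling: there is $k$ such that every closed disk of $\Lambda^\xi$ is covered by at most $k$ closed disks of half its radius. 3. $\Lambda^\xi$ is uniformly disconnected: there is $C>1$ such that for all $x\in\Lambda^\xi$ and $r>0$ there is a closed $A\subset\Lambda^\xi$ with $B_{r/C}(x)\cap\Lambda^\xi\subset A\subset B_r(x)$ and $\operatorname{dist}(A,\Lambda^\xi\setminus A)\ge r/C$ (where the distance to the empty set is $\infty$). 4. $\Lambda^\xi$ is quasi-symmetrically equivalent to the symbolic Cantor set $\{0,1\}^{\mathbb N}$ with the metric $d(x,y)=2^{-L(x,y)}$, where $L(x,y)$ is the length of the longest common initial segment of $x$ and $y$ ($L=\infty$ and $d=0$ if $x=y$). That is, there are a non-constant map $h$ from $\Lambda^\xi$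 onto $\{0,1\}^{\mathbb N}$ and a homeomorphism $\eta:[0,\infty)\to[0,\infty)$ such that for all $x,y,z\in\Lambda^\xi$ and $t>0$, $|x-y|_p\le t\,|x-z|_p$ implies $d(h(x),h(y))\le\eta(t)\,d(h(x),h(z))$. -/

import Mathlib

open scoped NNReal

namespace UnconventionalLimit

/-! ### Metric notions -/

section Metric

/-- A bounded set `E` with at least two points is uniformly perfect if, for some `c > 0`, every
closed annulus `c * r ≤ dist x x₀ ≤ r` with `x₀ ∈ E` and `0 < r < diam E` meets `E`. -/
def IsUniformlyPerfect {X : Type*} [MetricSpace X] (E : Set X) : Prop :=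
  Bornology.IsBounded E ∧ E.Nontrivial ∧
    ∃ c : ℝ, 0 < c ∧ ∀ x₀ ∈ E, ∀ r : ℝ, 0 < r → r < Metric.diam E →
      ∃ x ∈ E, c * r ≤ dist x x₀ ∧ dist x x₀ ≤ r

/-- There is a `k` such that every disk is covered by at most `k` disks of half its radius. -/
def IsDoublingSpace (X : Type*) [MetricSpace X] : Prop :=
  ∃ k : ℕ, ∀ (x : X) (r : ℝ), 0 < r →
    ∃ S : Finset X, S.card ≤ k ∧
      Metric.closedBall x r ⊆ ⋃ y ∈ S, Metric.closedBall y (r / 2)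

/-- There is `C > 1` such that for all `x` and `r > 0` some closed `A` satisfies
`B_{r/C}(x) ⊆ A ⊆ B_r(x)` and `dist(A, X \ A) ≥ r / C`. The last condition is written pointwise,
so that it is vacuous for `A = X` (the distance to the empty set is infinite). -/
def IsUniformlyDisconnected (X : Type*) [MetricSpace X] : Prop :=
  ∃ C : ℝ, 1 < C ∧ ∀ (x : X) (r : ℝ), 0 < r →
    ∃ A : Set X, IsClosed A ∧ Metric.closedBall x (r / C) ⊆ A ∧ A ⊆ Metric.closedBall x r ∧
      ∀ a ∈ A, ∀ b ∉ A, r / C ≤ dist a b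

/-- A map is quasi-symmetric if it is not constant and, for some homeomorphism `η` of `[0, ∞)`,
`d(x, y) ≤ t d(x, z)` implies `d(f x, f y) ≤ η(t) d(f x, f z)` for all `x, y, z` and `t > 0`. -/
def IsQuasiSymmetric {X Y : Type*} [MetricSpace X] [MetricSpace Y] (f : X → Y) : Prop :=
  (∃ x y : X, f x ≠ f y) ∧
    ∃ η : ℝ≥0 ≃ₜ ℝ≥0, ∀ (x y z : X) (t : ℝ≥0), 0 < t →
      nndist x y ≤ t * nndist x z → nndist (f x) (f y) ≤ η t * nndist (f x) (f z)

/-- There is a quasi-symmetric map from `X` onto `Y` (such a map is automatically injective). -/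
def QuasiSymmetricallyEquivalent (X Y : Type*) [MetricSpace X] [MetricSpace Y] : Prop :=
  ∃ f : X → Y, IsQuasiSymmetric f ∧ Function.Surjective f

/-- The symbolic Cantor set: all sequences of zeros and ones. -/
def SymbolicCantor : Type := ℕ → Fin 2

/-- The metric `2 ^ (-L(x, y))`, where `L(x, y)` is the length of the longest common initial
segment of `x` and `y`, and the distance is `0` if `x = y`. With indices starting at `0` this
length is the first index at which the sequences differ, i.e. `PiNat.firstDiff x y`. -/
noncomputable instance : MetricSpace SymbolicCantor :=
  PiNat.metricSpace (E := fun _ : ℕ => Fin 2)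

end Metric

/-! ### Unconventional limit sets -/

section LimitSet

variable {p : ℕ} [Fact p.Prime]

/-- `wordMap f w n = f (w 0) ∘ f (w 1) ∘ ⋯ ∘ f (w (n - 1))`. -/
def wordMap {X ι : Type*} (f : ι → X → X) (w : ℕ → ι) : ℕ → X → X
  | 0 => id
  | n + 1 => wordMap f w n ∘ f (w n)

/-- The map `F_{α, n} = ∑ i, ∏ j, f_{ξ i j (α₁)} ∘ ⋯ ∘ f_{ξ i j (αₙ)}`. -/
noncomputable def unconventionalMap {M L N : ℕ} (f : Fin N → ℤ_[p] → ℤ_[p])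
    (ξ : Fin M → Fin L → Fin N → Fin N) (α : ℕ → Fin N) (n : ℕ) : ℤ_[p] → ℤ_[p] :=
  fun x => ∑ i, ∏ j, wordMap f (fun k => ξ i j (α k)) n x

/-- The set of all the maps `F_{α, n}` with `n ≥ 1`. -/
def unconventionalFamily {M L N : ℕ} (f : Fin N → ℤ_[p] → ℤ_[p])
    (ξ : Fin M → Fin L → Fin N → Fin N) : Set (ℤ_[p] → ℤ_[p]) :=
  {F | ∃ (n : ℕ) (α : ℕ → Fin N), 1 ≤ n ∧ F = unconventionalMap f ξ α n}

/-- The points with a disk `B` such that `F(B) ∩ B = ∅` for all but finitely many `F ∈ 𝓕`. -/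
def discontinuitySet (𝓕 : Set (ℤ_[p] → ℤ_[p])) : Set ℤ_[p] :=
  {x | ∃ r : ℝ, 0 < r ∧
    {F ∈ 𝓕 | (F '' Metric.closedBall x r ∩ Metric.closedBall x r).Nonempty}.Finite}

/-- The unconventional limit set: the complement in `ℤ_[p]` of the discontinuity set. -/
def unconventionalLimitSet {M L N : ℕ} (f : Fin N → ℤ_[p] → ℤ_[p])
    (ξ : Fin M → Fin L → Fin N → Fin N) : Set ℤ_[p] :=
  (discontinuitySet (unconventionalFamily f ξ))ᶜ

end LimitSet

/-! ### The example: the index `k : Fin 2` stands for the index `k + 1` in `{1, 2}` -/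

/-- `f₁ x = p x` and `f₂ x = p x + 1 - p`. -/
noncomputable def exampleMaps (p : ℕ) [Fact p.Prime] : Fin 2 → ℤ_[p] → ℤ_[p] :=
  ![fun x => (p : ℤ_[p]) * x, fun x => (p : ℤ_[p]) * x + 1 - (p : ℤ_[p])]

/-- The action of `a ∈ {1, 2}` on the indices `{1, 2}`: the index `b` goes to `1` if `a + b` is
odd and to `2` if `a + b` is even. -/
def indexAction (a : ℕ) (k : Fin 2) : Fin 2 :=
  if Odd (a + ((k : ℕ) + 1)) then 0 else 1

/-- The limit set `Λ^ξ` of the example, for a matrix `ξ` with entries in `{1, 2}`. -/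
noncomputable def exampleLimitSet (p : ℕ) [Fact p.Prime] (ξ : Matrix (Fin 2) (Fin 2) ℕ) :
    Set ℤ_[p] :=
  unconventionalLimitSet (exampleMaps p) (fun i j => indexAction (ξ i j))

end UnconventionalLimit

/-! A word of length `n` acts by `x ↦ p^n x + S_n`, with `S_n` a partial sum of `t_α = (1 - p) ∑ α_k
p^k`, and swapping the letters replaces `t_α` by `1 - t_α`. So `F_{α,n}` is uniformly within
`p^{-n}` of a constant `P(t_α)`, where `P` is a quadratic polynomial depending on `ξ`, and the limit
set is the compact set of all `P(t_α)` (`exampleLimitSet_eq_range`).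

Doubling and uniform disconnectedness hold for every subset of `ℤ_[p]`. For uniform perfectness,
flip one digit of `α`: this moves `t_α` by some `h` of norm exactly `p^{-k}`, and `P(t + h) - P(t) =
h (P'(t) + c₂ h)`, whose size can be tuned through `k` (`exists_norm_mul_add_mul_comparable`).

For the quasi-symmetry, describe a point by yes/no questions, `p` per digit, and keep only the
answers not forced by earlier ones. The distance of two codes is `2^{-c}`, with `c` the number of
kept questions before the first disagreement. Uniform perfectness bounds the gaps between kept
questions, so `c` is comparable, up to constants, to the `n` in the distance `p^{-n}` of the points;
this gives `η(t) = C (t^p + t^{1/K})` (`level_distortion`). -/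

namespace UnconventionalLimit

/-! ### Coding a tree of binary questions by its branching points -/

section Coding

variable {X : Type*} (q : ℕ → X → Fin 2)

/-- The question `q τ` is not settled for `x` by the answers to the questions before it. -/
def Branches (x : X) (τ : ℕ) : Prop :=
  ∃ y, (∀ i < τ, q i y = q i x) ∧ q τ y ≠ q τ x

/-- The sequence of the answers of `x` to the questions that are not settled by previous ones. -/
noncomputable def branchCode (x : X) : SymbolicCantor :=
  fun k => q (Nat.nth (Branches q x) k) x

variable {q}

theorem branches_congr {x y : X} {τ : ℕ} (h : ∀ i < τ, q i x = q i y) {i : ℕ} (hi : i < τ) :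
    Branches q x i ↔ Branches q y i := by
  have h' : ∀ j ≤ i, q j x = q j y := fun j hj => h j (by omega)
  unfold Branches
  rw [h' i le_rfl]
  refine exists_congr fun z => and_congr_left fun _ => forall₂_congr fun j hj => ?_
  rw [h' j hj.le]

open Classical in
theorem count_branches_congr {x y : X} {τ : ℕ} (h : ∀ i < τ, q i x = q i y) {σ : ℕ}
    (hσ : σ ≤ τ) : Nat.count (Branches q x) σ = Nat.count (Branches q y) σ := by
  induction σ with
  | zero => simp
  | succ n ih =>
    rw [Nat.count_succ, Nat.count_succ, ih (by omega)]
    simp only [branches_congr h (show n < τ by omega)]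

-- The `k`-th branching point of `x` comes before `σ`, where the histories of `x` and `y` coincide,
-- so it is also the `k`-th one of `y`.
open Classical in
theorem branchCode_eq_of_lt_count {x y : X} {σ k : ℕ} (h : ∀ i < σ, q i x = q i y)
    (hk : k < Nat.count (Branches q x) σ) (hinf : {τ | Branches q x τ}.Infinite) :
    branchCode q x k = branchCode q y k := by
  have hlt := Nat.nth_lt_of_lt_count hk
  have hmem : Branches q x (Nat.nth (Branches q x) k) := Nat.nth_mem_of_infinite hinf k
  have hcount : Nat.count (Branches q y) (Nat.nth (Branches q x) k) = k := by
    rw [← count_branches_congr h hlt.le]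
    exact Nat.count_nth_of_infinite hinf k
  have hnth : Nat.nth (Branches q y) k = Nat.nth (Branches q x) k := by
    conv_lhs => rw [← hcount]
    exact Nat.nth_count ((branches_congr h hlt).1 hmem)
  unfold branchCode
  rw [hnth]
  exact h _ hlt

-- A question separating two points with equal histories is a branching point of both, with the same
-- rank.
open Classical in
theorem branchCode_ne {x y : X} {σ : ℕ} (h : ∀ i < σ, q i x = q i y) (hσ : q σ x ≠ q σ y) :
    branchCode q x (Nat.count (Branches q x) σ) ≠ branchCode q y (Nat.count (Branches q x) σ) := by
  have hx : Branches q x σ := ⟨y, fun i hi => (h i hi).symm, hσ.symm⟩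
  have hy : Branches q y σ := ⟨x, h, hσ⟩
  unfold branchCode
  rw [Nat.nth_count hx, count_branches_congr h le_rfl, Nat.nth_count hy]
  exact hσ

open Classical in
theorem dist_branchCode {x y : X} {σ : ℕ} (h : ∀ i < σ, q i x = q i y) (hσ : q σ x ≠ q σ y)
    (hinf : {τ | Branches q x τ}.Infinite) :
    dist (branchCode q x) (branchCode q y) = (1 / 2 : ℝ) ^ Nat.count (Branches q x) σ := by
  have hne := branchCode_ne h hσ
  have hne' : branchCode q x ≠ branchCode q y := fun e => hne (congrFun e _)
  refine (PiNat.dist_eq_of_ne (E := fun _ : ℕ => Fin 2) hne').trans ?_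
  congr 1
  apply le_antisymm
  · by_contra! hlt
    exact hne (PiNat.apply_eq_of_lt_firstDiff hlt)
  · by_contra! hlt
    exact PiNat.apply_firstDiff_ne (E := fun _ : ℕ => Fin 2) hne'
      (branchCode_eq_of_lt_count h hlt hinf)

theorem symbolicCantor_dist_le {s t : SymbolicCantor} {n : ℕ} (h : ∀ i < n, s i = t i) :
    dist s t ≤ (1 / 2 : ℝ) ^ n :=
  (PiNat.mem_cylinder_iff_dist_le (E := fun _ : ℕ => Fin 2)).1 h

theorem exists_branchCode_prefix [Nonempty X] (hinf : ∀ x : X, {τ | Branches q x τ}.Infinite)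
    (s : SymbolicCantor) (n : ℕ) : ∃ x : X, ∀ i < n, branchCode q x i = s i := by
  classical
  induction n with
  | zero => exact ⟨Classical.arbitrary X, by simp⟩
  | succ n ih =>
    obtain ⟨x, hx⟩ := ih
    by_cases hxn : branchCode q x n = s n
    · exact ⟨x, fun i hi => (Nat.lt_succ_iff_lt_or_eq.1 hi).elim (hx i) fun e => e ▸ hxn⟩
    -- If letter `n` is wrong, cross to the other side of the `n`-th branching; the earlier letters
    -- are kept.
    obtain ⟨y, hy, hyn⟩ : Branches q x (Nat.nth (Branches q x) n) :=
      Nat.nth_mem_of_infinite (hinf x) n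
    have hcount : Nat.count (Branches q x) (Nat.nth (Branches q x) n) = n :=
      Nat.count_nth_of_infinite (hinf x) n
    have hne := branchCode_ne (fun i hi => (hy i hi).symm) hyn.symm
    rw [hcount] at hne
    refine ⟨y, fun i hi => (Nat.lt_succ_iff_lt_or_eq.1 hi).elim (fun hi => ?_) fun e => ?_⟩
    · rw [← hx i hi]
      exact (branchCode_eq_of_lt_count (fun i hi => (hy i hi).symm) (by rwa [hcount])
        (hinf x)).symm
    · subst e
      -- With two letters, differing from the wrong letter means being the right one.
      generalize branchCode q x i = a, branchCode q y i = b, s i = c at hxn hne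
      revert a b c
      decide

/-- The unsettled questions occur with bounded gaps. -/
def BranchesWithin (q : ℕ → X → Fin 2) (K : ℕ) : Prop :=
  ∀ x τ, ∃ σ, τ ≤ σ ∧ σ < τ + K ∧ Branches q x σ

theorem BranchesWithin.infinite {K : ℕ} (h : BranchesWithin q K) (x : X) :
    {τ | Branches q x τ}.Infinite :=
  Set.infinite_of_forall_exists_gt fun τ => by
    obtain ⟨σ, h1, -, h2⟩ := h x (τ + 1)
    exact ⟨σ, h2, h1⟩

open Classical in
theorem count_branches_add_le (x : X) (τ d : ℕ) :
    Nat.count (Branches q x) (τ + d) ≤ Nat.count (Branches q x) τ + d := by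
  rw [Nat.count_add]
  exact Nat.add_le_add_left (Nat.count_le _) _

open Classical in
theorem BranchesWithin.le_count {K : ℕ} (h : BranchesWithin q K) (x : X) (τ m : ℕ) :
    Nat.count (Branches q x) τ + m ≤ Nat.count (Branches q x) (τ + K * m) := by
  induction m with
  | zero => simp
  | succ m ih =>
    obtain ⟨σ, h1, h2, h3⟩ := h x (τ + K * m)
    have h4 : Nat.count (Branches q x) (σ + 1) ≤ Nat.count (Branches q x) (τ + K * (m + 1)) :=
      Nat.count_monotone _ (by rw [mul_add]; omega)
    have h5 : Nat.count (Branches q x) (τ + K * m) ≤ Nat.count (Branches q x) σ :=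
      Nat.count_monotone _ h1
    rw [Nat.count_succ, if_pos h3] at h4
    omega

/-- The homeomorphism `t ↦ c * (t ^ a + t ^ b)` of `[0, ∞)`. -/
theorem exists_homeomorph_pow_add_pow {c : ℝ≥0} (hc : 0 < c) {a b : ℝ} (ha : 0 < a) (hb : 0 < b) :
    ∃ η : ℝ≥0 ≃ₜ ℝ≥0, ∀ t, η t = c * (t ^ a + t ^ b) := by
  set f : ℝ≥0 → ℝ≥0 := fun t => c * (t ^ a + t ^ b) with hf
  have hmono : StrictMono f := fun s t hst =>
    mul_lt_mul_of_pos_left (add_lt_add (NNReal.rpow_lt_rpow hst ha) (NNReal.rpow_lt_rpow hst hb)) hc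
  have hcont : Continuous f := continuous_const.mul
    ((NNReal.continuous_rpow_const ha.le).add (NNReal.continuous_rpow_const hb.le))
  have hsurj : Function.Surjective f := by
    intro s
    set T : ℝ≥0 := (s / c) ^ (1 / a)
    have hT : s ≤ f T := by
      have : T ^ a = s / c := by
        rw [← NNReal.rpow_mul, one_div_mul_cancel ha.ne', NNReal.rpow_one]
      simp only [hf, this]
      rw [mul_add, mul_div_cancel₀ _ hc.ne']
      exact le_self_add
    have h0 : f 0 ≤ s := by simp [hf, ha.ne', hb.ne']
    obtain ⟨t, -, ht⟩ := intermediate_value_Icc zero_le hcont.continuousOn ⟨h0, hT⟩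
    exact ⟨t, ht⟩
  exact ⟨(hmono.orderIsoOfSurjective f hsurj).toHomeomorph, fun t => rfl⟩

end Coding

/-! ### Quasi-symmetry of the branch code -/

section QuasiSymmetry

variable {X : Type*} [MetricSpace X]

/-- The distances of `X` are powers of `1 / p`, and the first of the questions `q` on which two
points at distance `p⁻¹ ^ n` differ is one of `q (n * p), …, q (n * p + p - 1)`. -/
def IsDigitSystem (q : ℕ → X → Fin 2) (p : ℕ) : Prop :=
  ∀ x y : X, x ≠ y → ∃ n σ : ℕ, dist x y = (p : ℝ)⁻¹ ^ n ∧ n * p ≤ σ ∧ σ < (n + 1) * p ∧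
    (∀ i < σ, q i x = q i y) ∧ q σ x ≠ q σ y

variable {q : ℕ → X → Fin 2} {p K : ℕ}

theorem continuous_branchCode (hp : 2 ≤ p) (hq : IsDigitSystem q p) (hK : BranchesWithin q K) :
    Continuous (branchCode q) := by
  classical
  have hp0 : (0 : ℝ) < (p : ℝ)⁻¹ := by positivity
  rw [Metric.continuous_iff]
  intro x ε hε
  obtain ⟨m, hm⟩ := exists_pow_lt_of_lt_one hε (show (1 / 2 : ℝ) < 1 by norm_num)
  refine ⟨(p : ℝ)⁻¹ ^ (K * m), by positivity, fun y hy => ?_⟩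
  rcases eq_or_ne x y with rfl | hne
  · simpa using hε
  obtain ⟨n, σ, hd, h1, h2, h3, h4⟩ := hq x y hne
  rw [dist_comm, hd] at hy
  have hn : K * m < n := (pow_lt_pow_iff_right_of_lt_one₀ hp0
    (inv_lt_one_of_one_lt₀ (by exact_mod_cast hp))).1 hy
  rw [dist_comm, dist_branchCode h3 h4 (hK.infinite x)]
  refine lt_of_le_of_lt (pow_le_pow_of_le_one (by norm_num) (by norm_num) ?_) hm
  calc m ≤ Nat.count (Branches q x) (0 + K * m) := by simpa using hK.le_count x 0 m
    _ ≤ _ := Nat.count_monotone _ (by nlinarith)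

/-- The range is compact, hence closed, and it is dense because every finite prefix is realised. -/
theorem surjective_branchCode [CompactSpace X] [Nonempty X] (hp : 2 ≤ p)
    (hq : IsDigitSystem q p) (hK : BranchesWithin q K) : Function.Surjective (branchCode q) := by
  intro s
  have hclosed := (isCompact_range (continuous_branchCode hp hq hK)).isClosed
  refine hclosed.closure_subset (Metric.mem_closure_iff.2 fun ε hε => ?_)
  obtain ⟨m, hm⟩ := exists_pow_lt_of_lt_one hε (show (1 / 2 : ℝ) < 1 by norm_num)
  obtain ⟨x, hx⟩ := exists_branchCode_prefix hK.infinite s m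
  refine ⟨_, ⟨x, rfl⟩, lt_of_le_of_lt (symbolicCantor_dist_le fun i hi => (hx i hi).symm) hm⟩

/-- The distortion estimate behind quasi-symmetry, in terms of levels: `n₁`, `n₂` are the levels
of the distances and `c₁`, `c₂` those of the distances of the images. -/
theorem level_distortion {c₁ c₂ n₁ n₂ p K : ℕ} {t : ℝ≥0} (hp : 2 ≤ p) (hK : 0 < K)
    (ht : (p : ℝ≥0)⁻¹ ^ n₁ ≤ t * (p : ℝ≥0)⁻¹ ^ n₂)
    (hle : n₁ ≤ n₂ → c₂ ≤ c₁ + p * (n₂ - n₁) + p)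
    (hge : n₂ < n₁ → p * (n₁ - n₂) + K * c₂ ≤ K * c₁ + (p + K)) :
    (2 : ℝ≥0)⁻¹ ^ c₁ ≤ 2 ^ (2 * p + K) * (t ^ (p : ℝ) + t ^ (1 / K : ℝ)) * 2⁻¹ ^ c₂ := by
  have hp0 : (0 : ℝ≥0) < p := by positivity
  have h2p : (p : ℝ≥0) ≤ 2 ^ p := by exact_mod_cast Nat.lt_two_pow_self.le
  have hone : (2 : ℝ≥0)⁻¹ ^ c₁ = 2 ^ c₂ * 2⁻¹ ^ c₁ * 2⁻¹ ^ c₂ := by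
    rw [mul_right_comm, ← mul_pow, mul_inv_cancel₀ two_ne_zero, one_pow, one_mul]
  rw [hone]
  refine mul_le_mul_of_nonneg_right ?_ zero_le
  -- If `n₂ = n₁ + d`, then `t ≥ p^d` and `2^(c₂ - c₁) ≤ 2^p (2^d)^p ≤ 2^p t^p`. If `n₁ = n₂ + d`,
  -- then `t ≥ p^{-d}`, and `p ≤ 2^p` gives `2^(K (c₂ - c₁)) ≤ 2^(p + K) 2^{-pd} ≤ 2^(p + K) t`;
  -- take `K`-th roots.
  rcases le_or_gt n₁ n₂ with h | h
  · obtain ⟨d, rfl⟩ := Nat.exists_eq_add_of_le h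
    have hc := hle h
    rw [Nat.add_sub_cancel_left] at hc
    have htd : (p : ℝ≥0) ^ d ≤ t := by
      have : (p : ℝ≥0)⁻¹ ^ n₁ * p ^ d ≤ (p : ℝ≥0)⁻¹ ^ n₁ * t := by
        calc (p : ℝ≥0)⁻¹ ^ n₁ * p ^ d ≤ t * (p : ℝ≥0)⁻¹ ^ (n₁ + d) * p ^ d := by gcongr
          _ = (p : ℝ≥0)⁻¹ ^ n₁ * t * ((p : ℝ≥0)⁻¹ * p) ^ d := by rw [pow_add, mul_pow]; ring
          _ = _ := by rw [inv_mul_cancel₀ hp0.ne', one_pow, mul_one]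
      exact le_of_mul_le_mul_left this (by positivity)
    calc (2 : ℝ≥0) ^ c₂ * 2⁻¹ ^ c₁ ≤ 2 ^ (c₁ + p * d + p) * 2⁻¹ ^ c₁ := by
          gcongr; exact one_le_two
      _ = 2 ^ p * (2 ^ d) ^ p * (2 * 2⁻¹) ^ c₁ := by rw [mul_pow]; ring
      _ = 2 ^ p * (2 ^ d) ^ p := by rw [mul_inv_cancel₀ two_ne_zero, one_pow, mul_one]
      _ ≤ 2 ^ (2 * p + K) * t ^ p := by
          gcongr
          · exact one_le_two
          · omega
          · refine le_trans ?_ htd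
            gcongr
            exact_mod_cast hp
      _ ≤ _ := by
          gcongr
          rw [NNReal.rpow_natCast]
          exact le_self_add
  · obtain ⟨d, rfl⟩ := Nat.exists_eq_add_of_le h.le
    have hc := hge h
    rw [Nat.add_sub_cancel_left] at hc
    have htd : 1 ≤ t * (p : ℝ≥0) ^ d := by
      have : (p : ℝ≥0)⁻¹ ^ n₂ * 1 ≤ (p : ℝ≥0)⁻¹ ^ n₂ * (t * p ^ d) := by
        calc (p : ℝ≥0)⁻¹ ^ n₂ * 1 = (p : ℝ≥0)⁻¹ ^ (n₂ + d) * p ^ d := by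
              rw [pow_add, mul_assoc, ← mul_pow, inv_mul_cancel₀ hp0.ne', one_pow]
          _ ≤ t * (p : ℝ≥0)⁻¹ ^ n₂ * p ^ d := by gcongr
          _ = _ := by ring
      exact le_of_mul_le_mul_left this (by positivity)
    have key : ((2 : ℝ≥0) ^ c₂ * 2⁻¹ ^ c₁) ^ K ≤ (2 ^ (2 * p + K) * t ^ (1 / K : ℝ)) ^ K := by
      have ht' : (t ^ (1 / K : ℝ)) ^ K = t := by
        rw [one_div]; exact NNReal.rpow_inv_natCast_pow t hK.ne'
      rw [mul_pow _ (t ^ (1 / K : ℝ)), ht']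
      calc ((2 : ℝ≥0) ^ c₂ * 2⁻¹ ^ c₁) ^ K
          = 2 ^ (K * c₂) * 2⁻¹ ^ (K * c₁) * 1 := by rw [mul_pow]; ring
        _ ≤ 2 ^ (K * c₂) * 2⁻¹ ^ (K * c₁) * (t * (2 ^ p) ^ d) := by
            gcongr
            exact htd.trans (by gcongr)
        _ = 2 ^ (p * d + K * c₂) * 2⁻¹ ^ (K * c₁) * t := by ring
        _ ≤ 2 ^ (K * c₁ + (p + K)) * 2⁻¹ ^ (K * c₁) * t := by
            gcongr; exact one_le_two
        _ = 2 ^ (p + K) * t * (2 * 2⁻¹) ^ (K * c₁) := by rw [mul_pow]; ring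
        _ = 2 ^ (p + K) * t := by rw [mul_inv_cancel₀ two_ne_zero, one_pow, mul_one]
        _ ≤ (2 ^ (2 * p + K)) ^ K * t := by
            rw [← pow_mul]
            gcongr
            · exact one_le_two
            · nlinarith
    refine (le_of_pow_le_pow_left₀ hK.ne' zero_le key).trans ?_
    gcongr
    exact le_add_self

theorem quasiSymmetricallyEquivalent_symbolicCantor [CompactSpace X] [Nonempty X] (hp : 2 ≤ p)
    (hK0 : 0 < K) (hq : IsDigitSystem q p) (hK : BranchesWithin q K) :
    QuasiSymmetricallyEquivalent X SymbolicCantor := by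
  classical
  have hsurj := surjective_branchCode hp hq hK
  refine ⟨branchCode q, ⟨?_, ?_⟩, hsurj⟩
  · obtain ⟨x, hx⟩ := hsurj (fun _ => 0)
    obtain ⟨y, hy⟩ := hsurj (fun _ => 1)
    refine ⟨x, y, fun h => ?_⟩
    have := congrFun (hx.symm.trans (h.trans hy)) 0
    simp at this
  · obtain ⟨η, hη⟩ := exists_homeomorph_pow_add_pow (c := 2 ^ (2 * p + K)) (by positivity)
      (show (0 : ℝ) < p by positivity) (show (0 : ℝ) < 1 / K by positivity)
    refine ⟨η, fun x y z t _ h => ?_⟩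
    rcases eq_or_ne x y with rfl | hxy
    · simp
    rcases eq_or_ne x z with rfl | hxz
    · simp [hxy] at h
    obtain ⟨n₁, σ₁, hd₁, h1, h2, h3, h4⟩ := hq x y hxy
    obtain ⟨n₂, σ₂, hd₂, k1, k2, k3, k4⟩ := hq x z hxz
    have e₁ : nndist x y = (p : ℝ≥0)⁻¹ ^ n₁ := by ext; simpa using hd₁
    have e₂ : nndist x z = (p : ℝ≥0)⁻¹ ^ n₂ := by ext; simpa using hd₂
    have f₁ : nndist (branchCode q x) (branchCode q y) =
        (2 : ℝ≥0)⁻¹ ^ Nat.count (Branches q x) σ₁ := by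
      ext; simpa using dist_branchCode h3 h4 (hK.infinite x)
    have f₂ : nndist (branchCode q x) (branchCode q z) =
        (2 : ℝ≥0)⁻¹ ^ Nat.count (Branches q x) σ₂ := by
      ext; simpa using dist_branchCode k3 k4 (hK.infinite x)
    rw [e₁, e₂] at h
    rw [f₁, f₂, hη]
    refine level_distortion hp hK0 h (fun hn => ?_) (fun hn => ?_)
    · obtain ⟨d, rfl⟩ := Nat.exists_eq_add_of_le hn
      rw [Nat.add_sub_cancel_left, add_assoc]
      refine le_trans (Nat.count_monotone _ ?_) (count_branches_add_le x σ₁ (p * d + p))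
      nlinarith
    · obtain ⟨d, rfl⟩ := Nat.exists_eq_add_of_le hn.le
      rw [Nat.add_sub_cancel_left]
      -- Since `σ₂ < (n₂ + 1) p` and `(n₂ + d) p ≤ σ₁`, at least `m` full blocks of `K` questions
      -- fit between them.
      set m := (p * d - p) / K with hm
      have h5 : Nat.count (Branches q x) σ₂ + m ≤ Nat.count (Branches q x) σ₁ := by
        have hd : 0 < d := by omega
        refine (hK.le_count x σ₂ m).trans (Nat.count_monotone _ ?_)
        have : K * m ≤ p * d - p := Nat.mul_div_le _ _
        have : p ≤ p * d := Nat.le_mul_of_pos_right p hd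
        have : p * d + n₂ * p = (n₂ + d) * p := by ring
        have : (n₂ + 1) * p = n₂ * p + p := by ring
        omega
      have h6 : p * d - p < K * m + K := by
        have := Nat.lt_mul_div_succ (p * d - p) hK0
        rw [mul_add, mul_one] at this
        exact this
      have h7 := Nat.mul_le_mul_left K h5
      rw [mul_add] at h7
      omega

end QuasiSymmetry

/-! ### Subsets of the `p`-adic integers -/

section PadicSubsets

variable {p : ℕ} [Fact p.Prime]

theorem dist_le_pow_iff_dvd (x y : ℤ_[p]) (n : ℕ) :
    dist x y ≤ (p : ℝ)⁻¹ ^ n ↔ (p : ℤ_[p]) ^ n ∣ x - y := by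
  rw [dist_eq_norm, ← Ideal.mem_span_singleton, ← PadicInt.norm_le_pow_iff_mem_span_pow,
    zpow_neg, zpow_natCast, inv_pow]

theorem dist_le_pow_iff_appr_eq (x y : ℤ_[p]) (n : ℕ) :
    dist x y ≤ (p : ℝ)⁻¹ ^ n ↔ x.appr n = y.appr n := by
  rw [dist_le_pow_iff_dvd, ← Ideal.mem_span_singleton, ← PadicInt.ker_toZModPow,
    RingHom.mem_ker, map_sub, sub_eq_zero]
  change ((x.appr n : ℕ) : ZMod (p ^ n)) = (y.appr n : ℕ) ↔ _
  rw [ZMod.natCast_eq_natCast_iff]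
  exact ⟨fun h => h.eq_of_lt_of_lt (x.appr_lt n) (y.appr_lt n), fun h => by rw [h]⟩

theorem exists_dist_eq_pow {x y : ℤ_[p]} (h : x ≠ y) : ∃ n : ℕ, dist x y = (p : ℝ)⁻¹ ^ n := by
  refine ⟨(x - y).valuation, ?_⟩
  rw [dist_eq_norm, PadicInt.norm_eq_zpow_neg_valuation (sub_ne_zero.2 h), zpow_neg, zpow_natCast,
    inv_pow]

/-- The coefficient of `p ^ n` in the `p`-adic expansion of `x`. -/
noncomputable def padicDigit (n : ℕ) (x : ℤ_[p]) : ℕ := x.appr (n + 1) / p ^ n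

theorem padicDigit_lt (n : ℕ) (x : ℤ_[p]) : padicDigit n x < p := by
  have := x.appr_lt (n + 1)
  rw [pow_succ] at this
  exact Nat.div_lt_of_lt_mul this

theorem appr_succ_eq (n : ℕ) (x : ℤ_[p]) :
    x.appr (n + 1) = p ^ n * padicDigit n x + x.appr n := by
  have h1 : x.appr (n + 1) % p ^ n = x.appr n := by
    have h := (Nat.modEq_iff_dvd' (x.appr_mono n.le_succ)).2 (x.dvd_appr_sub_appr n (n + 1) n.le_succ)
    rw [← Nat.mod_eq_of_lt (x.appr_lt n)]
    exact h.symm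
  conv_lhs => rw [← Nat.div_add_mod (x.appr (n + 1)) (p ^ n), h1]
  rfl

theorem dist_le_pow_iff_padicDigit_eq (x y : ℤ_[p]) (n : ℕ) :
    dist x y ≤ (p : ℝ)⁻¹ ^ n ↔ ∀ i < n, padicDigit i x = padicDigit i y := by
  rw [dist_le_pow_iff_appr_eq]
  constructor
  · intro h i hi
    have : x.appr (i + 1) = y.appr (i + 1) := by
      rw [← dist_le_pow_iff_appr_eq] at h ⊢
      refine h.trans (pow_le_pow_of_le_one (by positivity) ?_ hi)
      exact inv_le_one_of_one_le₀ (by exact_mod_cast (Fact.out : p.Prime).one_le)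
    rw [padicDigit, padicDigit, this]
  · intro h
    induction n with
    | zero => rfl
    | succ n ih => rw [appr_succ_eq, appr_succ_eq, h n n.lt_succ_self, ih fun i hi => h i (by omega)]

/-- The question whether the digit number `τ / p` is `τ % p`. -/
noncomputable def digitQuestion (τ : ℕ) (x : ℤ_[p]) : Fin 2 :=
  if padicDigit (τ / p) x = τ % p then 1 else 0

theorem isDigitSystem_digitQuestion (E : Set ℤ_[p]) :
    IsDigitSystem (fun τ (x : E) => digitQuestion τ (x : ℤ_[p])) p := by
  intro x y hxy
  have hp : p.Prime := Fact.out
  have hp1 : (1 : ℝ) < p := by exact_mod_cast hp.one_lt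
  obtain ⟨n, hn⟩ := exists_dist_eq_pow (Subtype.coe_injective.ne hxy)
  have heq := (dist_le_pow_iff_padicDigit_eq (x : ℤ_[p]) y n).1 hn.le
  have hne : padicDigit n (x : ℤ_[p]) ≠ padicDigit n (y : ℤ_[p]) := by
    intro h
    have : dist (x : ℤ_[p]) y ≤ (p : ℝ)⁻¹ ^ (n + 1) :=
      (dist_le_pow_iff_padicDigit_eq _ _ _).2 fun i hi =>
        (Nat.lt_succ_iff_lt_or_eq.1 hi).elim (heq i) fun e => e ▸ h
    rw [hn] at this
    exact absurd this (not_le.2 (pow_lt_pow_right_of_lt_one₀ (by positivity)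
      (inv_lt_one_of_one_lt₀ hp1) n.lt_succ_self))
  have hex : ∃ σ, digitQuestion σ (x : ℤ_[p]) ≠ digitQuestion σ (y : ℤ_[p]) ∧
      σ < (n + 1) * p := by
    -- This question asks whether digit `n` is that of `x`: only `x` answers yes.
    refine ⟨n * p + padicDigit n (x : ℤ_[p]), ?_, ?_⟩
    · have h1 : (n * p + padicDigit n (x : ℤ_[p])) / p = n := by
        rw [mul_comm, Nat.mul_add_div hp.pos, Nat.div_eq_of_lt (padicDigit_lt _ _), add_zero]
      have h2 : (n * p + padicDigit n (x : ℤ_[p])) % p = padicDigit n (x : ℤ_[p]) := by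
        rw [mul_comm, Nat.mul_add_mod, Nat.mod_eq_of_lt (padicDigit_lt _ _)]
      simp [digitQuestion, h1, h2, hne.symm]
    · have := padicDigit_lt n (x : ℤ_[p])
      rw [add_mul, one_mul]
      omega
  classical
  refine ⟨n, Nat.find hex, hn, ?_, (Nat.find_spec hex).2, fun i hi => ?_, (Nat.find_spec hex).1⟩
  · by_contra! hlt
    refine (Nat.find_spec hex).1 ?_
    rw [digitQuestion, digitQuestion, heq _ (Nat.div_lt_of_lt_mul (hlt.trans_eq (mul_comm _ _)))]
  · have := Nat.find_min hex hi
    by_contra h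
    exact this ⟨h, hi.trans (Nat.find_spec hex).2⟩

/-- Every closed annulus with radii `c * r ≤ r ≤ 1` centred in `E` meets `E`. -/
def MeetsAnnuli (E : Set ℤ_[p]) (c : ℝ) : Prop :=
  ∀ x₀ ∈ E, ∀ r : ℝ, 0 < r → r ≤ 1 → ∃ x ∈ E, c * r ≤ dist x x₀ ∧ dist x x₀ ≤ r

variable {E : Set ℤ_[p]} {c : ℝ}

theorem MeetsAnnuli.isUniformlyPerfect (h : MeetsAnnuli E c) (hc : 0 < c) (hE : E.Nonempty) :
    IsUniformlyPerfect E := by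
  obtain ⟨x₀, hx₀⟩ := hE
  refine ⟨(Metric.isBounded_closedBall (x := (0 : ℤ_[p])) (r := 1)).subset fun x _ => ?_, ?_,
    c, hc, fun x hx r hr hrE => h x hx r hr (hrE.le.trans ?_)⟩
  · simpa using PadicInt.norm_le_one x
  · obtain ⟨x, hx, h1, -⟩ := h x₀ hx₀ 1 one_pos le_rfl
    exact ⟨x, hx, x₀, hx₀, dist_pos.1 (by linarith)⟩
  · exact Metric.diam_le_of_forall_dist_le zero_le_one fun x _ y _ => by
      rw [dist_eq_norm]; exact PadicInt.norm_le_one _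

theorem MeetsAnnuli.exists_branchesWithin (h : MeetsAnnuli E c) (hc : 0 < c) :
    ∃ K, 0 < K ∧ BranchesWithin (fun τ (x : E) => digitQuestion τ (x : ℤ_[p])) K := by
  have hp : p.Prime := Fact.out
  have hp1 : (1 : ℝ) < p := by exact_mod_cast hp.one_lt
  have hp0 : (0 : ℝ) < (p : ℝ)⁻¹ := by positivity
  have hpi : (p : ℝ)⁻¹ < 1 := inv_lt_one_of_one_lt₀ hp1
  obtain ⟨m, hm⟩ := exists_pow_lt_of_lt_one hc hpi
  -- As `p^{-m} < c`, the annulus of outer radius `p^{-(τ/p + 1)}` has a point at distance `p^{-n}`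
  -- from `x` with `τ/p < n ≤ τ/p + m`; the first question separating it from `x` is the required
  -- branching.
  refine ⟨(m + 2) * p, Nat.mul_pos (by omega) hp.pos, fun x τ => ?_⟩
  obtain ⟨y, hy, h1, h2⟩ := h x x.2 ((p : ℝ)⁻¹ ^ (τ / p + 1)) (by positivity)
    (pow_le_one₀ hp0.le hpi.le)
  have hne : x ≠ ⟨y, hy⟩ := by
    rintro rfl
    rw [dist_self] at h1
    have : 0 < c * (p : ℝ)⁻¹ ^ (τ / p + 1) := by positivity
    linarith
  obtain ⟨n, σ, hd, k1, k2, k3, k4⟩ := isDigitSystem_digitQuestion E x ⟨y, hy⟩ hne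
  rw [dist_comm, show dist (x : ℤ_[p]) y = _ from hd] at h1 h2
  have hn1 : τ / p + 1 ≤ n := (pow_le_pow_iff_right_of_lt_one₀ hp0 hpi).1 h2
  have hn2 : n < m + (τ / p + 1) := by
    refine (pow_lt_pow_iff_right_of_lt_one₀ hp0 hpi).1 (lt_of_lt_of_le ?_ h1)
    rw [pow_add]
    gcongr
  have hτ1 : τ < (τ / p + 1) * p := by
    rw [mul_comm]; exact Nat.lt_mul_div_succ τ hp.pos
  have hτ2 : τ / p * p ≤ τ := Nat.div_mul_le_self τ p
  refine ⟨σ, ?_, ?_, ⟨y, hy⟩, fun i hi => (k3 i hi).symm, k4.symm⟩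
  · exact (hτ1.le.trans (Nat.mul_le_mul_right p hn1)).trans k1
  · have : (n + 1) * p ≤ (τ / p + (m + 2)) * p := Nat.mul_le_mul_right p (by omega)
    rw [add_mul (τ / p)] at this
    omega

theorem MeetsAnnuli.quasiSymmetricallyEquivalent (h : MeetsAnnuli E c) (hc : 0 < c)
    (hE : E.Nonempty) (hcomp : IsCompact E) :
    QuasiSymmetricallyEquivalent E SymbolicCantor := by
  have := hE.to_subtype
  have := isCompact_iff_compactSpace.1 hcomp
  obtain ⟨K, hK0, hK⟩ := h.exists_branchesWithin hc
  exact quasiSymmetricallyEquivalent_symbolicCantor (Fact.out : p.Prime).two_le hK0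
    (isDigitSystem_digitQuestion E) hK

/-- A point within `r` of a closed ball of radius `r` already lies in that ball. -/
theorem isUniformlyDisconnected_of_isUltrametricDist (X : Type*) [MetricSpace X]
    [IsUltrametricDist X] : IsUniformlyDisconnected X := by
  refine ⟨2, one_lt_two, fun x r hr => ⟨Metric.closedBall x r, Metric.isClosed_closedBall,
    Metric.closedBall_subset_closedBall (by linarith), subset_rfl, fun a ha b hb => ?_⟩⟩
  rw [Metric.mem_closedBall] at ha hb
  by_contra! hlt
  refine hb ((dist_triangle_max b a x).trans (max_le ?_ ha))
  rw [dist_comm]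
  linarith

/-- With `p^{-n}` the largest power at most `r`, points of an `r`-ball share their first `n` digits.
Sorting by digit `n` gives `p` classes of diameter at most `p^{-(n+1)} ≤ r / 2`. -/
theorem isDoublingSpace_subtype (E : Set ℤ_[p]) : IsDoublingSpace E := by
  classical
  have hp : p.Prime := Fact.out
  have hp2 : (2 : ℝ) ≤ p := by exact_mod_cast hp.two_le
  have hp0 : (0 : ℝ) < (p : ℝ)⁻¹ := by positivity
  have hpi : (p : ℝ)⁻¹ < 1 := inv_lt_one_of_one_lt₀ (by linarith)
  refine ⟨p, fun x r hr => ?_⟩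
  have hex : ∃ n : ℕ, (p : ℝ)⁻¹ ^ n ≤ r := by
    obtain ⟨n, hn⟩ := exists_pow_lt_of_lt_one hr hpi
    exact ⟨n, hn.le⟩
  obtain ⟨n, hnr, hn⟩ : ∃ n : ℕ, (p : ℝ)⁻¹ ^ n ≤ r ∧
      ∀ y z : E, dist y z ≤ r → dist (y : ℤ_[p]) z ≤ (p : ℝ)⁻¹ ^ n := by
    refine ⟨Nat.find hex, Nat.find_spec hex, fun y z hyz => ?_⟩
    rcases eq_or_ne (y : ℤ_[p]) z with e | hne
    · rw [e, dist_self]; positivity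
    obtain ⟨m, hm⟩ := exists_dist_eq_pow hne
    rw [hm]
    refine pow_le_pow_of_le_one hp0.le hpi.le (Nat.find_min' hex ?_)
    rw [← hm]
    exact hyz
  -- A representative of each digit class; the value `x` for an empty class is harmless.
  let g : ℕ → E := fun j =>
    if h : ∃ y ∈ Metric.closedBall x r, padicDigit n (y : ℤ_[p]) = j then h.choose else x
  refine ⟨(Finset.range p).image g, Finset.card_image_le.trans (by simp), fun y hy => ?_⟩
  have h : ∃ z ∈ Metric.closedBall x r, padicDigit n (z : ℤ_[p]) = padicDigit n (y : ℤ_[p]) :=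
    ⟨y, hy, rfl⟩
  have hg : g (padicDigit n (y : ℤ_[p])) = h.choose := dif_pos h
  obtain ⟨hz, hzd⟩ := h.choose_spec
  rw [← hg] at hz hzd
  simp only [Set.mem_iUnion, Finset.mem_image, Finset.mem_range]
  refine ⟨_, ⟨padicDigit n (y : ℤ_[p]), padicDigit_lt _ _, rfl⟩, ?_⟩
  set z := g (padicDigit n (y : ℤ_[p]))
  have hyz : dist (y : ℤ_[p]) z ≤ (p : ℝ)⁻¹ ^ n := by
    refine (dist_triangle_max (y : ℤ_[p]) x z).trans (max_le (hn y x hy) ?_)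
    rw [dist_comm]
    exact hn z x hz
  have hyz' : dist (y : ℤ_[p]) z ≤ (p : ℝ)⁻¹ ^ (n + 1) := by
    rw [dist_le_pow_iff_padicDigit_eq] at hyz ⊢
    exact fun i hi => (Nat.lt_succ_iff_lt_or_eq.1 hi).elim (hyz i) fun e => by rw [e, hzd]
  rw [Metric.mem_closedBall]
  refine (show dist y z = dist (y : ℤ_[p]) z from rfl).trans_le (hyz'.trans ?_)
  have hhalf : (p : ℝ)⁻¹ ≤ 2⁻¹ := inv_anti₀ two_pos hp2
  rw [pow_succ, div_eq_mul_inv]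
  gcongr

end PadicSubsets

/-! ### The limit set of the example -/

section Example

variable {p : ℕ} [Fact p.Prime]

/-- The point `(1 - p) * ∑ k < n, α k * p ^ k`, which is `f (α 0) ∘ ⋯ ∘ f (α (n - 1))` at `0`. -/
noncomputable def cantorSum (α : ℕ → Fin 2) (n : ℕ) : ℤ_[p] :=
  (1 - p) * ∑ k ∈ Finset.range n, (p : ℤ_[p]) ^ k * ((α k : ℕ) : ℤ_[p])

/-- The point `(1 - p) * ∑ k, α k * p ^ k` of the limit set of `f₁`, `f₂`. -/
noncomputable def cantorPoint (α : ℕ → Fin 2) : ℤ_[p] :=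
  (1 - p) * ∑' k, (p : ℤ_[p]) ^ k * ((α k : ℕ) : ℤ_[p])

theorem norm_pow_mul_le (k : ℕ) (a : ℤ_[p]) : ‖(p : ℤ_[p]) ^ k * a‖ ≤ (p : ℝ)⁻¹ ^ k := by
  rw [norm_mul, norm_pow, PadicInt.norm_p]
  exact mul_le_of_le_one_right (by positivity) (PadicInt.norm_le_one a)

theorem inv_prime_lt_one : (p : ℝ)⁻¹ < 1 :=
  inv_lt_one_of_one_lt₀ (by exact_mod_cast (Fact.out : p.Prime).one_lt)

theorem summable_inv_prime_pow : Summable fun k : ℕ => (p : ℝ)⁻¹ ^ k :=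
  summable_geometric_of_lt_one (by positivity) inv_prime_lt_one

theorem summable_pow_mul (a : ℕ → ℤ_[p]) : Summable fun k => (p : ℤ_[p]) ^ k * a k :=
  Summable.of_norm_bounded summable_inv_prime_pow fun k => norm_pow_mul_le k (a k)

theorem continuous_cantorPoint : Continuous (cantorPoint (p := p)) := by
  refine continuous_const.mul (continuous_tsum (fun k => ?_) summable_inv_prime_pow
    fun k α => norm_pow_mul_le k _)
  exact continuous_const.mul
    ((continuous_of_discreteTopology (f := fun a : Fin 2 => ((a : ℕ) : ℤ_[p]))).comp
      (continuous_apply k))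

theorem pow_dvd_cantorSum_sub_cantorPoint (α : ℕ → Fin 2) (n : ℕ) :
    (p : ℤ_[p]) ^ n ∣ cantorSum α n - cantorPoint α := by
  have h := (summable_pow_mul (p := p) fun k => ((α k : ℕ) : ℤ_[p])).sum_add_tsum_nat_add n
  have h' : ∑' k, (p : ℤ_[p]) ^ (k + n) * ((α (k + n) : ℕ) : ℤ_[p]) =
      (p : ℤ_[p]) ^ n * ∑' k, (p : ℤ_[p]) ^ k * ((α (k + n) : ℕ) : ℤ_[p]) := by
    rw [← (summable_pow_mul _).tsum_mul_left]
    exact tsum_congr fun k => by ring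
  rw [cantorSum, cantorPoint, ← h, h']
  exact ⟨-((1 - p) * ∑' k, (p : ℤ_[p]) ^ k * ((α (k + n) : ℕ) : ℤ_[p])), by ring⟩

theorem norm_one_sub_prime : ‖(1 - p : ℤ_[p])‖ = 1 := by
  rw [← PadicInt.norm_natCast_p_sub_one (p := p), ← norm_neg]
  congr 1
  push_cast [(Fact.out : p.Prime).one_le]
  ring

/-- Flip letter `k`; the factor `1 - p` is a unit. -/
theorem exists_norm_cantorPoint_sub_eq (α : ℕ → Fin 2) (k : ℕ) :
    ∃ β : ℕ → Fin 2, ‖(cantorPoint β - cantorPoint α : ℤ_[p])‖ = (p : ℝ)⁻¹ ^ k := by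
  refine ⟨Function.update α k (1 - α k), ?_⟩
  rw [cantorPoint, cantorPoint, ← mul_sub,
    ← (summable_pow_mul _).tsum_sub (summable_pow_mul _), tsum_eq_single k, ← mul_sub,
    norm_mul, norm_mul, norm_one_sub_prime, norm_pow, PadicInt.norm_p, one_mul,
    Function.update_self]
  · generalize α k = a
    fin_cases a <;> simp
  · intro i hi
    simp [Function.update_of_ne hi]

theorem wordMap_exampleMaps (w : ℕ → Fin 2) (n : ℕ) (x : ℤ_[p]) :
    wordMap (exampleMaps p) w n x = (p : ℤ_[p]) ^ n * x + cantorSum w n := by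
  induction n generalizing x with
  | zero => simp [wordMap, cantorSum]
  | succ n ih =>
    have h : ∀ a : Fin 2, exampleMaps p a x = p * x + (1 - p) * ((a : ℕ) : ℤ_[p]) := by
      intro a
      fin_cases a
      · simp [exampleMaps]
      · simp [exampleMaps, add_sub_assoc]
    rw [wordMap, Function.comp_apply, ih, h, cantorSum, cantorSum, Finset.sum_range_succ]
    ring

/-- The index action of `a` turns a point `t` of the limit set of `f₁`, `f₂` into
`actionConst a + actionSign a * t`: this is `t` for `a = 2` and `1 - t` for `a = 1`. -/
noncomputable def actionConst (p : ℕ) [Fact p.Prime] (a : ℕ) : ℤ_[p] := if a = 2 then 0 else 1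

/-- See `actionConst`. -/
noncomputable def actionSign (p : ℕ) [Fact p.Prime] (a : ℕ) : ℤ_[p] := if a = 2 then 1 else -1

/-- For `a = 1` every letter is flipped, and `(1 - p) ∑_{k<n} p^k = 1 - p^n`. -/
theorem cantorSum_indexAction {a : ℕ} (ha : a = 1 ∨ a = 2) (α : ℕ → Fin 2) (n : ℕ) :
    cantorSum (fun k => indexAction a (α k)) n =
      actionConst p a * (1 - (p : ℤ_[p]) ^ n) + actionSign p a * cantorSum α n := by
  induction n with
  | zero => simp [cantorSum]
  | succ n ih =>
    have h : ((indexAction a (α n) : ℕ) : ℤ_[p]) =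
        actionConst p a + actionSign p a * ((α n : ℕ) : ℤ_[p]) := by
      generalize α n = b
      rcases ha with rfl | rfl <;> fin_cases b <;>
        simp [indexAction, actionConst, actionSign, Nat.odd_iff]
    simp only [cantorSum] at ih ⊢
    rw [Finset.sum_range_succ, Finset.sum_range_succ, mul_add, ih, h]
    ring

theorem unconventionalMap_exampleMaps {ξ : Matrix (Fin 2) (Fin 2) ℕ}
    (hξ : ∀ i j, ξ i j = 1 ∨ ξ i j = 2) (α : ℕ → Fin 2) (n : ℕ) (x : ℤ_[p]) :
    unconventionalMap (exampleMaps p) (fun i j => indexAction (ξ i j)) α n x =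
      ∑ i, ∏ j, ((p : ℤ_[p]) ^ n * x + (actionConst p (ξ i j) * (1 - (p : ℤ_[p]) ^ n) +
        actionSign p (ξ i j) * cantorSum α n)) := by
  simp only [unconventionalMap, wordMap_exampleMaps, cantorSum_indexAction (hξ _ _)]

/-- The polynomial whose values on the limit set of `f₁`, `f₂` form the limit set of `ξ`. -/
noncomputable def limitPoly (ξ : Matrix (Fin 2) (Fin 2) ℕ) (t : ℤ_[p]) : ℤ_[p] :=
  ∑ i, ∏ j, (actionConst p (ξ i j) + actionSign p (ξ i j) * t)

theorem continuous_limitPoly (ξ : Matrix (Fin 2) (Fin 2) ℕ) :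
    Continuous (limitPoly (p := p) ξ) := by
  unfold limitPoly
  fun_prop

section

variable {ξ : Matrix (Fin 2) (Fin 2) ℕ}

theorem dist_unconventionalMap_le (hξ : ∀ i j, ξ i j = 1 ∨ ξ i j = 2) (α : ℕ → Fin 2) (n : ℕ)
    (x : ℤ_[p]) :
    dist (unconventionalMap (exampleMaps p) (fun i j => indexAction (ξ i j)) α n x)
      (limitPoly ξ (cantorPoint α)) ≤ (p : ℝ)⁻¹ ^ n := by
  rw [dist_le_pow_iff_dvd, unconventionalMap_exampleMaps hξ, limitPoly, ← Finset.sum_sub_distrib]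
  refine Finset.dvd_sum fun i _ => ?_
  obtain ⟨d, hd⟩ := pow_dvd_cantorSum_sub_cantorPoint (p := p) α n
  rw [Fin.prod_univ_two, Fin.prod_univ_two]
  have key : ∀ j, (p : ℤ_[p]) ^ n ∣ ((p : ℤ_[p]) ^ n * x + (actionConst p (ξ i j) * (1 - (p : ℤ_[p]) ^ n) +
      actionSign p (ξ i j) * cantorSum α n)) -
      (actionConst p (ξ i j) + actionSign p (ξ i j) * cantorPoint α) := fun j =>
    ⟨x - actionConst p (ξ i j) + actionSign p (ξ i j) * d, by
      linear_combination actionSign p (ξ i j) * hd⟩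
  exact dvd_mul_sub_mul (key 0) (key 1)

theorem injective_unconventionalMap (hξ : ∀ i j, ξ i j = 1 ∨ ξ i j = 2) (α : ℕ → Fin 2) :
    Function.Injective
      (unconventionalMap (exampleMaps p) (fun i j => indexAction (ξ i j)) α) := by
  intro m n h
  -- The leading coefficient is `2 p^(2n)`, so the second difference recovers `n`.
  have key : ∀ n, (unconventionalMap (exampleMaps p) (fun i j => indexAction (ξ i j)) α n 2 -
      2 * unconventionalMap (exampleMaps p) (fun i j => indexAction (ξ i j)) α n 1 +
      unconventionalMap (exampleMaps p) (fun i j => indexAction (ξ i j)) α n 0) =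
      4 * (p : ℤ_[p]) ^ (2 * n) := by
    intro n
    simp only [unconventionalMap_exampleMaps hξ, Fin.sum_univ_two, Fin.prod_univ_two]
    ring
  have h1 := key m
  rw [h, key n] at h1
  have h2 : 4 * p ^ (2 * n) = 4 * p ^ (2 * m) := by exact_mod_cast h1
  have h3 := Nat.pow_right_injective (Fact.out : p.Prime).two_le
    (Nat.eq_of_mul_eq_mul_left (by norm_num) h2)
  omega

theorem finite_range_unconventionalMap (hξ : ∀ i j, ξ i j = 1 ∨ ξ i j = 2) (n : ℕ) :
    (Set.range fun α => unconventionalMap (exampleMaps p)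
      (fun i j => indexAction (ξ i j)) α n).Finite := by
  refine (Set.finite_range fun (β : Fin n → Fin 2) (x : ℤ_[p]) =>
    ∑ i, ∏ j, ((p : ℤ_[p]) ^ n * x + (actionConst p (ξ i j) * (1 - (p : ℤ_[p]) ^ n) + actionSign p (ξ i j) *
      ((1 - p) * ∑ k : Fin n, (p : ℤ_[p]) ^ (k : ℕ) * ((β k : ℕ) : ℤ_[p]))))).subset ?_
  rintro _ ⟨α, rfl⟩
  refine ⟨fun k => α k, funext fun x => ?_⟩
  simp only [unconventionalMap_exampleMaps hξ, cantorSum, Finset.sum_range]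

theorem isCompact_range_limitPoly (ξ : Matrix (Fin 2) (Fin 2) ℕ) :
    IsCompact (Set.range fun α => limitPoly (p := p) ξ (cantorPoint α)) :=
  isCompact_range ((continuous_limitPoly ξ).comp continuous_cantorPoint)

/-- Off the compact range, only the finitely many maps with small `n` can meet a small disk. At
`P(t_α)`, the distinct maps `F_{α,n}` with `n` large all return. -/
theorem exampleLimitSet_eq_range (hξ : ∀ i j, ξ i j = 1 ∨ ξ i j = 2) :
    exampleLimitSet p ξ = Set.range fun α => limitPoly ξ (cantorPoint α) := by
  have hp0 : (0 : ℝ) ≤ (p : ℝ)⁻¹ := by positivity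
  have hp1 : (p : ℝ)⁻¹ < 1 := inv_prime_lt_one
  refine Set.Subset.antisymm (fun y hy => ?_) ?_
  · by_contra hyr
    refine hy ?_
    obtain ⟨δ, hδ, hball⟩ :=
      Metric.isOpen_iff.1 (isCompact_range_limitPoly (p := p) ξ).isClosed.isOpen_compl y hyr
    obtain ⟨N, hN⟩ := exists_pow_lt_of_lt_one (half_pos hδ) hp1
    refine ⟨δ / 2, half_pos hδ, ((Set.finite_lt_nat N).biUnion fun n _ =>
      finite_range_unconventionalMap hξ n).subset ?_⟩
    rintro _ ⟨⟨n, α, -, rfl⟩, _, ⟨z, -, rfl⟩, hz⟩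
    refine Set.mem_biUnion (show n < N from ?_) ⟨α, rfl⟩
    by_contra! hn
    refine hball (a := limitPoly ξ (cantorPoint α)) ?_ ⟨α, rfl⟩
    have h1 := dist_unconventionalMap_le hξ α n z
    have h2 : (p : ℝ)⁻¹ ^ n ≤ (p : ℝ)⁻¹ ^ N := pow_le_pow_of_le_one hp0 hp1.le hn
    rw [Metric.mem_closedBall] at hz
    rw [Metric.mem_ball]
    have h3 := dist_triangle_left (limitPoly ξ (cantorPoint α)) y
      (unconventionalMap (exampleMaps p) (fun i j => indexAction (ξ i j)) α n z)
    linarith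
  · rintro _ ⟨α, rfl⟩ ⟨r, hr, hfin⟩
    obtain ⟨N, hN⟩ := exists_pow_lt_of_lt_one hr hp1
    refine Set.infinite_of_injective_forall_mem
      (f := fun n => unconventionalMap (exampleMaps p) (fun i j => indexAction (ξ i j)) α
        (N + 1 + n))
      (fun m n h => add_left_cancel (injective_unconventionalMap hξ α h)) (fun n => ?_) hfin
    refine ⟨⟨N + 1 + n, α, by omega, rfl⟩, _,
      ⟨limitPoly ξ (cantorPoint α), Metric.mem_closedBall_self hr.le, rfl⟩, ?_⟩
    exact (dist_unconventionalMap_le hξ α _ _).trans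
      ((pow_le_pow_of_le_one hp0 hp1.le (by omega)).trans hN.le)

end

/-- Among the increments `h` of norm `p⁻¹ ^ k` of the argument, some `k` makes the increment
`h * (A + B * h)` of a quadratic polynomial comparable with a given `r ≤ 1`. -/
theorem exists_norm_mul_add_mul_comparable {A B : ℤ_[p]} {M r : ℝ} (hM : 0 < M)
    (hAB : M ≤ max ‖A‖ ‖B‖) (hr : 0 < r) (hr1 : r ≤ 1) :
    ∃ k : ℕ, ∀ h : ℤ_[p], ‖h‖ = (p : ℝ)⁻¹ ^ k →
      M * (p : ℝ)⁻¹ ^ 4 * r ≤ ‖h * (A + B * h)‖ ∧ ‖h * (A + B * h)‖ ≤ r := by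
  have hρ : (0 : ℝ) < (p : ℝ)⁻¹ := inv_pos.2 (by exact_mod_cast (Fact.out : p.Prime).pos)
  have hρ1 : (p : ℝ)⁻¹ < 1 := inv_prime_lt_one
  set ρ : ℝ := (p : ℝ)⁻¹
  -- The norm of the increment, by the ultrametric equality, unless `‖A‖ = ‖B‖ ρ^k`.
  set g : ℕ → ℝ := fun k => ρ ^ k * max ‖A‖ (‖B‖ * ρ ^ k) with hg
  have hA1 := PadicInt.norm_le_one A
  have hB1 := PadicInt.norm_le_one B
  have hA0 := norm_nonneg A
  have hB0 := norm_nonneg B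
  have hM1 : M ≤ 1 := hAB.trans (max_le hA1 hB1)
  have hg0 : ∀ k, 0 ≤ g k := fun k => by positivity
  have hsucc_le : ∀ k, g (k + 1) ≤ g k := fun k => by
    have : ρ ^ (k + 1) ≤ ρ ^ k := pow_le_pow_of_le_one hρ.le hρ1.le k.le_succ
    simp only [hg]
    gcongr
  have hle_succ : ∀ k, ρ ^ 2 * g k ≤ g (k + 1) := fun k => by
    have h1 : ρ * max ‖A‖ (‖B‖ * ρ ^ k) ≤ max ‖A‖ (‖B‖ * ρ ^ (k + 1)) := by
      rw [mul_max_of_nonneg _ _ hρ.le]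
      refine max_le_max (mul_le_of_le_one_left hA0 hρ1.le) (le_of_eq ?_)
      ring
    calc ρ ^ 2 * g k = ρ ^ (k + 1) * (ρ * max ‖A‖ (‖B‖ * ρ ^ k)) := by simp only [hg]; ring
      _ ≤ _ := mul_le_mul_of_nonneg_left h1 (by positivity)
  have hnorm : ∀ k, ‖A‖ ≠ ‖B‖ * ρ ^ k → ∀ h : ℤ_[p], ‖h‖ = ρ ^ k → ‖h * (A + B * h)‖ = g k := by
    intro k hk h hh
    rw [norm_mul, hh, PadicInt.norm_add_eq_max_of_ne (by rwa [norm_mul, hh]), norm_mul, hh]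
  have hex : ∃ k, g k ≤ r := by
    obtain ⟨k, hk⟩ := exists_pow_lt_of_lt_one hr hρ1
    refine ⟨k, le_trans (mul_le_of_le_one_right (by positivity) (max_le hA1 ?_)) hk.le⟩
    exact mul_le_one₀ hB1 (by positivity) (pow_le_one₀ hρ.le hρ1.le)
  classical
  -- Take the first `k` with `g k ≤ r`: one step shrinks `g` by at most `ρ²`, and `g 0 ≥ M`.
  obtain ⟨k, hk, hk'⟩ : ∃ k, g k ≤ r ∧ M * ρ ^ 2 * r ≤ g k := by
    refine ⟨Nat.find hex, Nat.find_spec hex, ?_⟩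
    rcases hn : Nat.find hex with _ | j
    · have h0 : g 0 = max ‖A‖ ‖B‖ := by simp [hg]
      rw [h0]
      refine le_trans ?_ hAB
      rw [mul_assoc]
      exact mul_le_of_le_one_right hM.le (mul_le_one₀ (pow_le_one₀ hρ.le hρ1.le) hr.le hr1)
    · have hj : r < g j := not_le.1 (Nat.find_min hex (by omega))
      calc M * ρ ^ 2 * r ≤ 1 * ρ ^ 2 * g j := by gcongr
        _ ≤ _ := by rw [one_mul]; exact hle_succ j
  have hρ2 : ρ ^ 2 ≤ 1 := pow_le_one₀ hρ.le hρ1.le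
  -- In a tie cancellation may occur; passing to `k + 1` breaks it and costs another `ρ²`.
  by_cases hne : ‖A‖ = ‖B‖ * ρ ^ k
  · have hB : 0 < ‖B‖ := by
      refine lt_of_le_of_ne hB0 fun e => ?_
      rw [← e, zero_mul] at hne
      rw [hne, ← e, max_self] at hAB
      linarith
    have hne' : ‖A‖ ≠ ‖B‖ * ρ ^ (k + 1) := by
      rw [hne]
      exact (mul_lt_mul_of_pos_left (pow_lt_pow_right_of_lt_one₀ hρ hρ1 k.lt_succ_self) hB).ne'
    refine ⟨k + 1, fun h hh => ?_⟩
    rw [hnorm _ hne' h hh]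
    refine ⟨?_, (hsucc_le k).trans hk⟩
    calc M * ρ ^ 4 * r = ρ ^ 2 * (M * ρ ^ 2 * r) := by ring
      _ ≤ ρ ^ 2 * g k := by gcongr
      _ ≤ _ := hle_succ k
  · refine ⟨k, fun h hh => ?_⟩
    rw [hnorm _ hne h hh]
    refine ⟨le_trans ?_ hk', hk⟩
    calc M * ρ ^ 4 * r = ρ ^ 2 * (M * ρ ^ 2 * r) := by ring
      _ ≤ 1 * (M * ρ ^ 2 * r) := by gcongr
      _ = _ := one_mul _

theorem meetsAnnuli_range_quadratic {c₀ c₁ c₂ : ℤ_[p]} (hc : c₁ ≠ 0 ∨ c₂ ≠ 0) :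
    ∃ c, 0 < c ∧ MeetsAnnuli (Set.range fun α : ℕ → Fin 2 =>
      c₀ + c₁ * cantorPoint α + c₂ * cantorPoint α ^ 2) c := by
  -- The derivative may vanish at some `t`, but then `c₂` bounds the maximum below.
  obtain ⟨M, hM, hMle⟩ : ∃ M : ℝ, 0 < M ∧ ∀ t : ℤ_[p], M ≤ max ‖c₁ + 2 * c₂ * t‖ ‖c₂‖ := by
    by_cases h : c₂ = 0
    · subst h
      exact ⟨‖c₁‖, norm_pos_iff.2 (hc.resolve_right (by simp)), fun t => by simp⟩
    · exact ⟨‖c₂‖, norm_pos_iff.2 h, fun t => le_max_right _ _⟩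
  have hρ : (0 : ℝ) < (p : ℝ)⁻¹ := inv_pos.2 (by exact_mod_cast (Fact.out : p.Prime).pos)
  refine ⟨M * (p : ℝ)⁻¹ ^ 4, by positivity, ?_⟩
  rintro _ ⟨α, rfl⟩ r hr hr1
  obtain ⟨k, hk⟩ := exists_norm_mul_add_mul_comparable hM (hMle (cantorPoint α)) hr hr1
  obtain ⟨β, hβ⟩ := exists_norm_cantorPoint_sub_eq (p := p) α k
  refine ⟨_, ⟨β, rfl⟩, ?_⟩
  convert hk _ hβ using 3 <;>
  · rw [dist_eq_norm]
    congr 1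
    ring

/-- If `c₂ = 0`, one row is constant and the other mixed, so `c₁ = ±1`. -/
theorem limitPoly_eq_quadratic {ξ : Matrix (Fin 2) (Fin 2) ℕ}
    (hξ : ∀ i j, ξ i j = 1 ∨ ξ i j = 2) :
    ∃ c₀ c₁ c₂ : ℤ_[p], (c₁ ≠ 0 ∨ c₂ ≠ 0) ∧ ∀ t, limitPoly ξ t = c₀ + c₁ * t + c₂ * t ^ 2 := by
  refine ⟨∑ i, actionConst p (ξ i 0) * actionConst p (ξ i 1),
    ∑ i, (actionConst p (ξ i 0) * actionSign p (ξ i 1) +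
      actionSign p (ξ i 0) * actionConst p (ξ i 1)),
    ∑ i, actionSign p (ξ i 0) * actionSign p (ξ i 1), ?_, fun t => ?_⟩
  · rcases hξ 0 0 with h₁ | h₁ <;> rcases hξ 0 1 with h₂ | h₂ <;> rcases hξ 1 0 with h₃ | h₃ <;>
      rcases hξ 1 1 with h₄ | h₄ <;>
      norm_num [h₁, h₂, h₃, h₄, actionConst, actionSign]
  · simp only [limitPoly, Fin.sum_univ_two, Fin.prod_univ_two]
    ring

theorem exists_meetsAnnuli_exampleLimitSet {ξ : Matrix (Fin 2) (Fin 2) ℕ}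
    (hξ : ∀ i j, ξ i j = 1 ∨ ξ i j = 2) : ∃ c, 0 < c ∧ MeetsAnnuli (exampleLimitSet p ξ) c := by
  obtain ⟨c₀, c₁, c₂, hc, h⟩ := limitPoly_eq_quadratic (p := p) hξ
  rw [exampleLimitSet_eq_range hξ]
  simp only [h]
  exact meetsAnnuli_range_quadratic hc

end Example

end UnconventionalLimit

theorem mainTheorem6 (p : ℕ) [Fact p.Prime] (ξ : Matrix (Fin 2) (Fin 2) ℕ)
    (hξ : ∀ i j, ξ i j = 1 ∨ ξ i j = 2) :
    UnconventionalLimit.IsUniformlyPerfect (UnconventionalLimit.exampleLimitSet p ξ) ∧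
    UnconventionalLimit.IsDoublingSpace (UnconventionalLimit.exampleLimitSet p ξ) ∧
    UnconventionalLimit.IsUniformlyDisconnected (UnconventionalLimit.exampleLimitSet p ξ) ∧
    UnconventionalLimit.QuasiSymmetricallyEquivalent
      (UnconventionalLimit.exampleLimitSet p ξ) UnconventionalLimit.SymbolicCantor := by
  obtain ⟨c, hc, h⟩ := UnconventionalLimit.exists_meetsAnnuli_exampleLimitSet (p := p) hξ
  have hE := UnconventionalLimit.exampleLimitSet_eq_range (p := p) hξ
  have hne : (UnconventionalLimit.exampleLimitSet p ξ).Nonempty := hE ▸ Set.range_nonempty _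
  have hcomp : IsCompact (UnconventionalLimit.exampleLimitSet p ξ) :=
    hE ▸ UnconventionalLimit.isCompact_range_limitPoly ξ
  exact ⟨h.isUniformlyPerfect hc hne, UnconventionalLimit.isDoublingSpace_subtype _,
    UnconventionalLimit.isUniformlyDisconnected_of_isUltrametricDist _,
    h.quasiSymmetricallyEquivalent hc hne hcomp⟩
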